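/- Let $\mathbb D=\{z\in\mathbb C:|z|<1\}$. Let $\mathcal H$ be the class of harmonic functions $f=h+\overline g$ on $\mathbb D$ with $h,g$ analytic in $\mathbb D$, $h(z)=z+\sum_{n\ge 2}a_nz^n$ and $g(z)=\sum_{n\ge 1}b_nz^n$. Let $\mathcal S_H^0$ be the class of those $f\in\mathcal H$ that are univalent and sense-preserving in $\mathbb D$ (i.e. $|h'|^2-|g'|^2>0$ there) and satisfy $b_1=0$. The dilatation of $f$ is $\omega=g'/h'$. The convolution of $f$ with $F=H+\overline G\in\mathcal H$, where $H(z)=z+\sum_{n\ge2}A_nz^n$ and $G(z)=\sum_{n\ge1}B_nz^n$, is $$(f*F)(z)=z+\sum_{n=2}^\infty a_nA_nz^n+\overline{\sum_{n=1}^\infty b_nB_nz^n}.$$ Let $\mathcal S^0(H_\pi)$ be the class of those $f\in\mathcal S_H^0$ that map $\mathbb D$ onto the left half-plane $H_\pi=\{w:\operatorname{Re}(e^{i\pi}w)>-\tfrac12\}=\{w:\operatorname{Re}w<\tfrac12\}$. Let $f_0=h_0+\overline{g_0}$, where $$h_0(z)=\frac{z-z^2/2}{(1-z)^2},\qquad g_0(z)=\frac{-z^2/2}{(1-z)^2}.$$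 Corollary. Let $f=h+\overline g\in\mathcal S^0(H_\pi)$ have the dilatation $\omega(z)=e^{i\theta}z^n$ in $\mathbb D$, where $n\in\{1,2\}$ and $\theta\in\mathbb R$. Then $f_0*f\in\mathcal S_H^0$. -/

import Mathlib

open Complex Metric
open scoped ComplexConjugate

/-- The `n`-th Taylor coefficient of `u` at the origin. -/
noncomputable def taylorCoeff (u : ℂ → ℂ) (n : ℕ) : ℂ :=
  iteratedDeriv n u 0 / (Nat.factorial n : ℂ)

/-- The Hadamard product `∑ aₙ bₙ zⁿ` of `u = ∑ aₙ zⁿ` and `v = ∑ bₙ zⁿ`. -/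
noncomputable def hadamard (u v : ℂ → ℂ) (z : ℂ) : ℂ :=
  ∑' n : ℕ, taylorCoeff u n * taylorCoeff v n * z ^ n

theorem taylorCoeff_bound {u : ℂ → ℂ} (hu : DifferentiableOn ℂ u (ball 0 1)) {s : ℝ}
    (hs0 : 0 ≤ s) (hs : s < 1) : ∃ M : ℝ, 0 ≤ M ∧ ∀ n, ‖taylorCoeff u n‖ * s ^ n ≤ M := by
  have hz : (s : ℂ) ∈ ball (0 : ℂ) 1 := by
    simpa [abs_of_nonneg hs0] using hs
  have h := (Complex.hasSum_taylorSeries_on_ball hu hz).summable.tendsto_atTop_zero.norm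
  obtain ⟨M, hM⟩ := h.bddAbove_range
  have key : ∀ n, ‖taylorCoeff u n‖ * s ^ n ≤ M := by
    intro n
    refine le_trans (le_of_eq ?_) (hM ⟨n, rfl⟩)
    simp [taylorCoeff, abs_of_nonneg hs0, div_eq_mul_inv]
    ring
  exact ⟨M, le_trans (by positivity) (key 0), key⟩

/-- The Hadamard product of two functions analytic in the unit disk is the sum of its
power series in the unit disk. -/
theorem hadamard_hasFPowerSeriesOnBall {u v : ℂ → ℂ} (hu : DifferentiableOn ℂ u (ball 0 1))
    (hv : DifferentiableOn ℂ v (ball 0 1)) :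
    HasFPowerSeriesOnBall (hadamard u v)
      (FormalMultilinearSeries.ofScalars ℂ fun n => taylorCoeff u n * taylorCoeff v n) 0 1 := by
  set p := FormalMultilinearSeries.ofScalars ℂ fun n => taylorCoeff u n * taylorCoeff v n with hp
  have hrad : (1 : ENNReal) ≤ p.radius := by
    refine ENNReal.le_of_forall_nnreal_lt fun r hr => ?_
    have hr1 : (r : ℝ) < 1 := by exact_mod_cast hr
    have hs1 : √(r : ℝ) < 1 := by
      rw [Real.sqrt_lt' one_pos]
      simpa using hr1
    obtain ⟨M, hM0, hM⟩ := taylorCoeff_bound hu (Real.sqrt_nonneg (r : ℝ)) hs1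
    obtain ⟨N, hN0, hN⟩ := taylorCoeff_bound hv (Real.sqrt_nonneg (r : ℝ)) hs1
    refine p.le_radius_of_bound (M * N) fun n => ?_
    have e : ‖p n‖ = ‖taylorCoeff u n‖ * ‖taylorCoeff v n‖ := by
      rw [hp, FormalMultilinearSeries.ofScalars_norm, norm_mul]
    have e2 : (r : ℝ) ^ n = √(r : ℝ) ^ n * √(r : ℝ) ^ n := by
      rw [← mul_pow, Real.mul_self_sqrt r.coe_nonneg]
    calc ‖p n‖ * (r : ℝ) ^ n
        = (‖taylorCoeff u n‖ * √(r : ℝ) ^ n) * (‖taylorCoeff v n‖ * √(r : ℝ) ^ n) := by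
          rw [e, e2]; ring
      _ ≤ M * N := mul_le_mul (hM n) (hN n) (by positivity) hM0
  have h := (p.hasFPowerSeriesOnBall (lt_of_lt_of_le one_pos hrad)).mono one_pos hrad
  refine h.congr fun z _ => ?_
  rw [FormalMultilinearSeries.sum, hadamard]
  refine tsum_congr fun n => ?_
  simp [hp, mul_comm]

theorem hadamard_differentiableOn {u v : ℂ → ℂ} (hu : DifferentiableOn ℂ u (ball 0 1))
    (hv : DifferentiableOn ℂ v (ball 0 1)) :
    DifferentiableOn ℂ (hadamard u v) (ball 0 1) := by
  have h := (hadamard_hasFPowerSeriesOnBall hu hv).differentiableOn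
  rwa [← ENNReal.coe_one, eball_coe, NNReal.coe_one] at h

theorem hadamard_zero (u v : ℂ → ℂ) : hadamard u v 0 = u 0 * v 0 := by
  rw [hadamard, tsum_eq_single 0]
  · simp [taylorCoeff]
  · intro n hn
    simp [hn]

theorem hadamard_deriv_zero {u v : ℂ → ℂ} (hu : DifferentiableOn ℂ u (ball 0 1))
    (hv : DifferentiableOn ℂ v (ball 0 1)) :
    deriv (hadamard u v) 0 = deriv u 0 * deriv v 0 := by
  have h := (hadamard_hasFPowerSeriesOnBall hu hv).hasFPowerSeriesAt.deriv
  rw [h]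
  simp [taylorCoeff, iteratedDeriv_one]

/-- The class `𝓗` of harmonic functions `f = h + conj g` in the unit disk, with `h`, `g` analytic
there, `h(z) = z + ∑_{n ≥ 2} aₙ zⁿ` and `g(z) = ∑_{n ≥ 1} bₙ zⁿ`.
Only the values of `h` and `g` in the unit disk matter. -/
structure HarmonicMap where
  h : ℂ → ℂ
  g : ℂ → ℂ
  h_analytic : DifferentiableOn ℂ h (ball 0 1)
  g_analytic : DifferentiableOn ℂ g (ball 0 1)
  h_zero : h 0 = 0
  h_deriv_zero : deriv h 0 = 1
  g_zero : g 0 = 0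

namespace HarmonicMap

/-- The function `f = h + conj g`. -/
noncomputable def toFun (f : HarmonicMap) (z : ℂ) : ℂ := f.h z + conj (f.g z)

/-- The Jacobian `|h'|² - |g'|²`. -/
noncomputable def jacobian (f : HarmonicMap) (z : ℂ) : ℝ :=
  ‖deriv f.h z‖ ^ 2 - ‖deriv f.g z‖ ^ 2

/-- The complex dilatation `g' / h'`. -/
noncomputable def dilatation (f : HarmonicMap) (z : ℂ) : ℂ := deriv f.g z / deriv f.h z

/-- The harmonic convolution `∑ aₙ Aₙ zⁿ + conj (∑ bₙ Bₙ zⁿ)`. -/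
noncomputable def conv (f F : HarmonicMap) : HarmonicMap where
  h := hadamard f.h F.h
  g := hadamard f.g F.g
  h_analytic := hadamard_differentiableOn f.h_analytic F.h_analytic
  g_analytic := hadamard_differentiableOn f.g_analytic F.g_analytic
  h_zero := by rw [hadamard_zero, f.h_zero, zero_mul]
  h_deriv_zero := by
    rw [hadamard_deriv_zero f.h_analytic F.h_analytic, f.h_deriv_zero, F.h_deriv_zero, one_mul]
  g_zero := by rw [hadamard_zero, f.g_zero, zero_mul]

end HarmonicMap

/-- `S_H`: the sense-preserving univalent functions in `𝓗`. -/
def classSH : Set HarmonicMap :=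
  {f | (∀ z ∈ ball (0 : ℂ) 1, 0 < f.jacobian z) ∧ Set.InjOn f.toFun (ball 0 1)}

/-- `S_H^0`: those `f ∈ S_H` with `b₁ = g'(0) = 0`. -/
def classSH0 : Set HarmonicMap := {f | f ∈ classSH ∧ deriv f.g 0 = 0}

/-- `H_γ = {w : Re (e^{iγ} w) > -1/2}`. -/
def slantedHalfPlane (γ : ℝ) : Set ℂ := {w | -(1 / 2 : ℝ) < (exp (γ * I) * w).re}

/-- `S^0(H_γ)`: those `f ∈ S_H^0` that map the unit disk onto `H_γ`. -/
def classS0 (γ : ℝ) : Set HarmonicMap :=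
  {f | f ∈ classSH0 ∧ f.toFun '' ball 0 1 = slantedHalfPlane γ}

theorem one_sub_ne_zero_of_mem {z : ℂ} (hz : z ∈ ball (0 : ℂ) 1) : (1 - z) ^ 2 ≠ 0 := by
  refine pow_ne_zero 2 fun h => ?_
  rw [← sub_eq_zero.mp h] at hz
  simp at hz

/-- `f₀ = h₀ + conj g₀`, `h₀ = (z - z²/2)/(1-z)²`, `g₀ = (-z²/2)/(1-z)²`. -/
noncomputable def f₀ : HarmonicMap where
  h z := (z - z ^ 2 / 2) / (1 - z) ^ 2
  g z := (-z ^ 2 / 2) / (1 - z) ^ 2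
  h_analytic := DifferentiableOn.div (by fun_prop) (by fun_prop)
    fun _ hz => one_sub_ne_zero_of_mem hz
  g_analytic := DifferentiableOn.div (by fun_prop) (by fun_prop)
    fun _ hz => one_sub_ne_zero_of_mem hz
  h_zero := by simp
  h_deriv_zero := by
    have h1 : HasDerivAt (fun z : ℂ => z - z ^ 2 / 2) (1 - 0) 0 := by
      simpa using (hasDerivAt_id' (0 : ℂ)).fun_sub (((hasDerivAt_id' (0 : ℂ)).fun_pow 2).div_const 2)
    have h2 : HasDerivAt (fun z : ℂ => (1 - z) ^ 2) (-2) 0 := by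
      simpa using ((hasDerivAt_id' (0 : ℂ)).const_sub 1).fun_pow 2
    simpa using (h1.fun_div h2 (by simp)).deriv
  g_zero := by simp

/-! Since `Re f = Re (h + g)`, the function `h + g` sends the disk into `Re w < 1/2` with value 0
and derivative 1 at the origin. Rigidity in the Schwarz lemma forces `h + g = z/(1+z)`
(`eq_div_one_add_of_re_lt_half`), and together with `g' = ω h'` this determines `h'` and `g'`.
Convolution with `f₀` is a differential operator: its parts are `H = (h + z h')/2` and `G = (g - z
g')/2`. So `H'` and `G'` are explicit, and `|G'| < |H'|` becomes a polynomial inequality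
(`norm_conv_numerator_lt_norm_conv_denominator`). For univalence, pass to `ζ = z/(1+z)` in the
half-plane `Re ζ < 1/2`. There `d(H - G)/dζ = 1/(1+ω) - ζ`, whose real part exceeds `1/2 - Re ζ`
because `|ω| < 1`. This bound and the positive Jacobian give injectivity by
`injOn_add_conj_of_re_deriv_sub_ge`. -/

/-! ### Taylor coefficients and convolution with `f₀` -/

theorem hasSum_taylorCoeff {u : ℂ → ℂ} (hu : DifferentiableOn ℂ u (ball 0 1)) {z : ℂ}
    (hz : z ∈ ball (0 : ℂ) 1) : HasSum (fun n => taylorCoeff u n * z ^ n) (u z) := by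
  refine (Complex.hasSum_taylorSeries_on_ball hu hz).congr_fun fun n => ?_
  simp [taylorCoeff, div_eq_mul_inv]
  ring

/-- Taylor coefficients are determined by any power series expansion in the unit disk. -/
theorem taylorCoeff_eq_of_hasSum {u : ℂ → ℂ} {c : ℕ → ℂ}
    (hu : DifferentiableOn ℂ u (ball 0 1))
    (h : ∀ z ∈ ball (0 : ℂ) 1, HasSum (fun n => c n * z ^ n) (u z)) (n : ℕ) :
    taylorCoeff u n = c n := by
  have key : ∀ d : ℕ → ℂ, (∀ z ∈ ball (0 : ℂ) 1, HasSum (fun n => d n * z ^ n) (u z)) →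
      HasFPowerSeriesAt u (FormalMultilinearSeries.ofScalars ℂ d) 0 := by
    intro d hd
    rw [hasFPowerSeriesAt_iff]
    filter_upwards [ball_mem_nhds (0 : ℂ) one_pos] with z hz
    simpa [mul_comm, FormalMultilinearSeries.coeff_ofScalars] using hd z hz
  have := (key _ fun z hz => hasSum_taylorCoeff hu hz).eq_formalMultilinearSeries (key c h)
  exact congrFun ((FormalMultilinearSeries.ofScalars_series_eq_iff (E := ℂ) _ _).1 this) n

theorem hasSum_mul_deriv {u : ℂ → ℂ} (hu : DifferentiableOn ℂ u (ball 0 1)) {z : ℂ}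
    (hz : z ∈ ball (0 : ℂ) 1) :
    HasSum (fun n : ℕ => (n : ℂ) * taylorCoeff u n * z ^ n) (z * deriv u z) := by
  have h := (hasSum_taylorCoeff (hu.deriv isOpen_ball) hz).mul_left z
  rw [← hasSum_nat_add_iff' 1]
  simp only [Finset.range_one, Finset.sum_singleton, Nat.cast_zero, zero_mul, sub_zero]
  refine h.congr_fun fun n => ?_
  have : (Nat.factorial n : ℂ) ≠ 0 := by exact_mod_cast Nat.factorial_ne_zero n
  have h2 : (n : ℂ) + 1 ≠ 0 := by exact_mod_cast Nat.succ_ne_zero n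
  simp only [taylorCoeff, iteratedDeriv_succ', Nat.factorial_succ]
  push_cast
  field_simp
  ring

theorem taylorCoeff_f₀_h (n : ℕ) : taylorCoeff f₀.h n = if n = 0 then 0 else (1 + (n : ℂ)) / 2 := by
  refine taylorCoeff_eq_of_hasSum
    (c := fun n => if n = 0 then 0 else (1 + (n : ℂ)) / 2) f₀.h_analytic (fun z hz => ?_) n
  have hz' : ‖z‖ < 1 := by simpa using hz
  have h1 : 1 - z ≠ 0 := by simpa using one_sub_ne_zero_of_mem hz
  rw [← hasSum_nat_add_iff' 1]
  -- With the zero constant term dropped, the coefficient of `z^(n+1)` is `(2 + n)/2`.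
  have h := (((hasSum_geometric_of_norm_lt_one hz').mul_left 2).add
    (hasSum_coe_mul_geometric_of_norm_lt_one hz')).mul_left (z / 2)
  convert! h using 1
  · ext n; simp; ring
  · simp [f₀]; field_simp; ring

theorem taylorCoeff_f₀_g (n : ℕ) : taylorCoeff f₀.g n = if n = 0 then 0 else (1 - (n : ℂ)) / 2 := by
  refine taylorCoeff_eq_of_hasSum
    (c := fun n => if n = 0 then 0 else (1 - (n : ℂ)) / 2) f₀.g_analytic (fun z hz => ?_) n
  have hz' : ‖z‖ < 1 := by simpa using hz
  have h1 : 1 - z ≠ 0 := by simpa using one_sub_ne_zero_of_mem hz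
  rw [← hasSum_nat_add_iff' 1]
  have h := (hasSum_coe_mul_geometric_of_norm_lt_one hz').mul_left (-z / 2)
  convert! h using 1
  · ext n; simp; ring
  · simp [f₀]; field_simp

/-- The coefficients `(1 + n)/2` average the identity and the Euler operator `z d/dz`. The formula
fails at `n = 0`, which is why `u 0 = 0` is needed. -/
theorem hadamard_f₀_h {u : ℂ → ℂ} (hu : DifferentiableOn ℂ u (ball 0 1)) (h0 : u 0 = 0) {z : ℂ}
    (hz : z ∈ ball (0 : ℂ) 1) : hadamard f₀.h u z = (u z + z * deriv u z) / 2 := by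
  refine HasSum.tsum_eq ?_
  refine (((hasSum_taylorCoeff hu hz).add (hasSum_mul_deriv hu hz)).div_const 2).congr_fun
    fun n => ?_
  rw [taylorCoeff_f₀_h]
  split_ifs with h
  · simp [h, taylorCoeff, h0]
  · ring

theorem hadamard_f₀_g {u : ℂ → ℂ} (hu : DifferentiableOn ℂ u (ball 0 1)) (h0 : u 0 = 0) {z : ℂ}
    (hz : z ∈ ball (0 : ℂ) 1) : hadamard f₀.g u z = (u z - z * deriv u z) / 2 := by
  refine HasSum.tsum_eq ?_
  refine (((hasSum_taylorCoeff hu hz).sub (hasSum_mul_deriv hu hz)).div_const 2).congr_fun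
    fun n => ?_
  rw [taylorCoeff_f₀_g]
  split_ifs with h
  · simp [h, taylorCoeff, h0]
  · ring

/-! ### Rigidity for maps into a half-plane -/

/-- The extremal case of the Schwarz lemma for maps of the unit disk into `Re w < 1/2`. -/
theorem eq_div_one_add_of_re_lt_half {φ : ℂ → ℂ} (hφ : DifferentiableOn ℂ φ (ball 0 1))
    (h0 : φ 0 = 0) (h1 : deriv φ 0 = 1) (hre : ∀ z ∈ ball (0 : ℂ) 1, (φ z).re < 1 / 2) {z : ℂ}
    (hz : z ∈ ball (0 : ℂ) 1) : φ z = z / (1 + z) := by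
  have hne : ∀ z ∈ ball (0 : ℂ) 1, 1 - φ z ≠ 0 := by
    intro z hz h
    have := hre z hz
    rw [← sub_eq_zero.mp h] at this
    norm_num at this
  set ψ : ℂ → ℂ := fun z => φ z / (1 - φ z) with hψ
  have hd : DifferentiableOn ℂ ψ (ball 0 1) := hφ.div (hφ.const_sub 1) hne
  have hψ0 : ψ 0 = 0 := by simp [hψ, h0]
  have hm : Set.MapsTo ψ (ball 0 1) (closedBall (ψ 0) 1) := by
    intro z hz
    rw [hψ0, mem_closedBall_zero_iff, norm_div]
    refine div_le_one_of_le₀ ?_ (norm_nonneg _)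
    -- `|φ| ≤ |1 - φ|` is equivalent to `Re φ ≤ 1/2`.
    rw [← sq_le_sq₀ (norm_nonneg _) (norm_nonneg _), ← normSq_eq_norm_sq, ← normSq_eq_norm_sq,
      normSq_apply, normSq_apply]
    simp
    nlinarith [hre z hz]
  have h0m : (0 : ℂ) ∈ ball (0 : ℂ) 1 := mem_ball_self one_pos
  have hφ' : HasDerivAt φ 1 0 := by
    rw [← h1]
    exact (hφ.differentiableAt (isOpen_ball.mem_nhds h0m)).hasDerivAt
  have hψ1 : deriv ψ 0 = 1 := by
    simpa [h0] using (hφ'.fun_div (hφ'.const_sub 1) (hne 0 h0m)).deriv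
  have := affine_of_mapsTo_ball_of_norm_dslope_eq_div hd hm h0m (by simp [hψ1]) hz
  simp only [dslope_same, hψ1, hψ0, zero_add, sub_zero, smul_eq_mul, mul_one] at this
  rw [hψ, div_eq_iff (hne z hz)] at this
  have hz1 : 1 + z ≠ 0 := by
    intro h
    rw [add_eq_zero_iff_eq_neg'.mp h] at hz
    simp at hz
  rw [eq_div_iff hz1]
  linear_combination this

/-! ### An injectivity criterion on the half-plane -/

theorem ContinuousLinearMap.isInvertible_of_apply_one_eq {a : ℝ} (ha : a ≠ 0) {A : ℝ →L[ℝ] ℝ} (hA : A 1 = a) :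
    A.IsInvertible := by
  refine ⟨ContinuousLinearEquiv.unitsEquivAut ℝ (Units.mk0 a ha), ?_⟩
  ext
  simp [hA]

/-- A harmonic function `U + conj V` on the half-plane `Re ζ < 1/2` with positive Jacobian is
injective if `Re (U' - V') ≥ 1/2 - Re ζ`: the level sets of its imaginary part are graphs over
the real axis, and its real part is strictly increasing along them. -/
theorem injOn_add_conj_of_re_deriv_sub_ge {U V U' V' : ℂ → ℂ}
    (hU : ∀ ζ : ℂ, ζ.re < 1 / 2 → HasDerivAt U (U' ζ) ζ)
    (hV : ∀ ζ : ℂ, ζ.re < 1 / 2 → HasDerivAt V (V' ζ) ζ)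
    (hJ : ∀ ζ : ℂ, ζ.re < 1 / 2 → ‖V' ζ‖ < ‖U' ζ‖)
    (hre : ∀ ζ : ℂ, ζ.re < 1 / 2 → 1 / 2 - ζ.re ≤ (U' ζ - V' ζ).re) :
    Set.InjOn (fun ζ => U ζ + conj (V ζ)) {ζ : ℂ | ζ.re < 1 / 2} := by
  have hS : IsOpen {ζ : ℂ | ζ.re < 1 / 2} := isOpen_lt continuous_re continuous_const
  set W : ℂ → ℂ := fun ζ => U ζ - V ζ with hWdef
  have hW : ∀ ζ : ℂ, ζ.re < 1 / 2 → HasDerivAt W (U' ζ - V' ζ) ζ :=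
    fun ζ h => (hU ζ h).sub (hV ζ h)
  have hWs : ∀ ζ : ℂ, ζ.re < 1 / 2 → HasStrictDerivAt W (U' ζ - V' ζ) ζ := by
    intro ζ h
    have hd : DifferentiableOn ℂ W {ζ : ℂ | ζ.re < 1 / 2} :=
      fun z hz => (hW z hz).differentiableAt.differentiableWithinAt
    have := ((hd.contDiffOn (n := 1) hS).contDiffAt (hS.mem_nhds h)).hasStrictDerivAt one_ne_zero
    rwa [(hW ζ h).deriv] at this
  -- the imaginary part on vertical lines
  have hvert : ∀ s t : ℝ, s < 1 / 2 →
      HasDerivAt (fun t : ℝ => (W ⟨s, t⟩).im) (U' ⟨s, t⟩ - V' ⟨s, t⟩).re t := by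
    intro s t hs
    have h1 : HasDerivAt (fun t : ℝ => (⟨s, t⟩ : ℂ)) I t := by
      have := ((ofRealCLM.hasDerivAt (x := t)).mul_const I).const_add (s : ℂ)
      simpa [mk_eq_add_mul_I] using this
    have h2 := (hW ⟨s, t⟩ hs).comp t h1
    have h3 := imCLM.hasFDerivAt.comp_hasDerivAt t h2
    simpa [Function.comp_def] using h3
  have hmono : ∀ s : ℝ, s < 1 / 2 → StrictMono fun t : ℝ => (W ⟨s, t⟩).im := by
    intro s hs
    refine strictMono_of_deriv_pos fun t => ?_
    rw [(hvert s t hs).deriv]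
    have := hre ⟨s, t⟩ hs
    simp only at this hs ⊢
    linarith
  have hsurj : ∀ s : ℝ, s < 1 / 2 → ∀ c : ℝ, ∃ t : ℝ, (W ⟨s, t⟩).im = c := by
    intro s hs c
    have hδ : 0 < 1 / 2 - s := by linarith
    have hdiff : Differentiable ℝ fun t : ℝ => (W ⟨s, t⟩).im :=
      fun t => (hvert s t hs).differentiableAt
    -- The slope bound is uniform in `t` on each vertical line, so `Im W` is unbounded in both
    -- directions.
    have hgrow : ∀ x y : ℝ, x ≤ y →
        (1 / 2 - s) * (y - x) ≤ (W ⟨s, y⟩).im - (W ⟨s, x⟩).im := by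
      intro x y hxy
      refine mul_sub_le_image_sub_of_le_deriv hdiff (fun t => ?_) hxy
      rw [(hvert s t hs).deriv]
      exact hre ⟨s, t⟩ hs
    have := hdiff.continuous.surjective ?_ ?_
    · exact this c
    · have h1 : Filter.Tendsto (fun t : ℝ => (1 / 2 - s) * t + (W ⟨s, 0⟩).im)
          Filter.atTop Filter.atTop :=
        Filter.tendsto_atTop_add_const_right _ _ (Filter.tendsto_id.const_mul_atTop hδ)
      refine Filter.tendsto_atTop_mono' _ ?_ h1
      filter_upwards [Filter.eventually_ge_atTop 0] with t ht
      have := hgrow 0 t ht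
      simp only [sub_zero] at this
      linarith
    · have h1 : Filter.Tendsto (fun t : ℝ => (1 / 2 - s) * t + (W ⟨s, 0⟩).im)
          Filter.atBot Filter.atBot :=
        Filter.tendsto_atBot_add_const_right _ _ (Filter.tendsto_id.const_mul_atBot hδ)
      refine Filter.tendsto_atBot_mono' _ ?_ h1
      filter_upwards [Filter.eventually_le_atBot 0] with t ht
      have := hgrow t 0 ht
      simp only [zero_sub] at this
      linarith
  intro ζ₁ h₁ ζ₂ h₂ heq
  simp only [Set.mem_ofPred_eq] at h₁ h₂
  -- `U + conj V` and `W = U - V` have the same imaginary part.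
  have him : (W ζ₁).im = (W ζ₂).im := by
    have := congrArg im heq
    simp only [add_im, conj_im] at this
    simp only [hWdef, sub_im]
    linarith
  set c := (W ζ₂).im with hc
  -- the level curve
  choose! τ hτ using fun s hs => hsurj s hs c
  have hτuniq : ∀ s t : ℝ, s < 1 / 2 → (W ⟨s, t⟩).im = c → t = τ s := fun s t hs ht =>
    (hmono s hs).injective (by simp only [ht, hτ s hs])
  have hτd : ∀ s : ℝ, s < 1 / 2 → DifferentiableAt ℝ τ s := by
    intro s hs
    have hWp := (hWs ⟨s, τ s⟩ hs).hasStrictFDerivAt.restrictScalars ℝ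
    have hp : HasStrictFDerivAt (fun p : ℝ × ℝ => equivRealProdCLM.symm p)
      (equivRealProdCLM.symm : ℝ × ℝ →L[ℝ] ℂ) (s, τ s) :=
      (equivRealProdCLM.symm : ℝ × ℝ →L[ℝ] ℂ).hasStrictFDerivAt
    obtain ⟨L, hf, hL⟩ : ∃ L : ℝ × ℝ →L[ℝ] ℝ,
        HasStrictFDerivAt (fun p : ℝ × ℝ => (W (equivRealProdCLM.symm p)).im) L (s, τ s) ∧
          L (0, 1) = (U' ⟨s, τ s⟩ - V' ⟨s, τ s⟩).re :=
      ⟨_, imCLM.hasStrictFDerivAt.comp (s, τ s) (hWp.comp (s, τ s) hp), by simp⟩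
    have hpos : 0 < (U' ⟨s, τ s⟩ - V' ⟨s, τ s⟩).re := by
      have := hre ⟨s, τ s⟩ hs
      simp only at this
      linarith
    -- The implicit function theorem gives a differentiable local solution; uniqueness on vertical
    -- lines identifies it with `τ`.
    have hinv := ContinuousLinearMap.isInvertible_of_apply_one_eq hpos.ne' (A := L ∘L .inr ℝ ℝ ℝ) (by simpa using hL)
    have hev := hf.eventually_apply_implicitFunctionOfProdDomain hinv
    have hder := hf.hasStrictFDerivAt_implicitFunctionOfProdDomain hinv
    refine hder.hasFDerivAt.differentiableAt.congr_of_eventuallyEq ?_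
    filter_upwards [hev, eventually_lt_nhds hs] with x hx hxs
    refine (hτuniq x _ hxs ?_).symm
    rw [← hτ s hs]
    exact hx
  set γ : ℝ → ℂ := fun s => ⟨s, τ s⟩ with hγ
  have hγd : ∀ s : ℝ, s < 1 / 2 → HasDerivAt γ (1 + deriv τ s * I) s := by
    intro s hs
    have h1 := ((hτd s hs).hasDerivAt.ofReal_comp.mul_const I)
    have h2 := (ofRealCLM.hasDerivAt (x := s)).add h1
    simpa [hγ, mk_eq_add_mul_I, Pi.add_def] using h2
  have hmonoR : StrictMonoOn (fun s => (U (γ s) + V (γ s)).re) (Set.Iio (1 / 2)) := by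
    have hd : ∀ s : ℝ, s < 1 / 2 → HasDerivAt (fun s => (U (γ s) + V (γ s)).re)
        ((U' (γ s) + V' (γ s)) * (1 + deriv τ s * I)).re s := by
      intro s hs
      have h2 := ((hU (γ s) hs).add (hV (γ s) hs)).comp s (hγd s hs)
      exact reCLM.hasFDerivAt.comp_hasDerivAt s h2
    refine strictMonoOn_of_deriv_pos (convex_Iio _)
      (fun s hs => (hd s hs).continuousAt.continuousWithinAt) fun s hs => ?_
    rw [interior_Iio] at hs
    rw [(hd s hs).deriv]
    have hzero : ((U' (γ s) - V' (γ s)) * (1 + deriv τ s * I)).im = 0 := by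
      have h2 := imCLM.hasFDerivAt.comp_hasDerivAt s ((hW (γ s) hs).comp s (hγd s hs))
      refine h2.unique ((hasDerivAt_const s c).congr_of_eventuallyEq ?_)
      filter_upwards [eventually_lt_nhds hs] with x hx using hτ x hx
    have hJs := hJ (γ s) hs
    have hpos : 0 < (U' (γ s) - V' (γ s)).re := by
      have h3 := hre (γ s) hs
      have h4 : (γ s).re < 1 / 2 := hs
      linarith
    generalize U' (γ s) = A at *
    generalize V' (γ s) = B at *
    generalize deriv τ s = d at *
    have hJs' : normSq B < normSq A := by
      rw [normSq_eq_norm_sq, normSq_eq_norm_sq]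
      exact pow_lt_pow_left₀ hJs (norm_nonneg _) two_ne_zero
    simp [normSq_apply] at hzero hpos hJs' ⊢
    -- On the level curve `(A - B)(1 + d i)` is real, so `1 + d i` is a real multiple of `conj (A -
    -- B)`. Hence `Re ((A + B)(1 + d i))` times `Re (A - B)` is the Jacobian `|A|² - |B|²`.
    have hk : 0 < (A.re + B.re - (A.im + B.im) * d) * (A.re - B.re) := by
      have : (A.re + B.re - (A.im + B.im) * d) * (A.re - B.re) =
          (A.re * A.re + A.im * A.im) - (B.re * B.re + B.im * B.im) := by
        linear_combination (-(A.im + B.im)) * hzero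
      linarith
    have := pos_of_mul_pos_left hk (sub_pos.2 hpos).le
    linarith
  have e₁ : γ ζ₁.re = ζ₁ := by
    rw [hγ]; exact Complex.ext rfl (hτuniq _ _ h₁ him).symm
  have e₂ : γ ζ₂.re = ζ₂ := by
    rw [hγ]; exact Complex.ext rfl (hτuniq _ _ h₂ hc.symm).symm
  have hs : ζ₁.re = ζ₂.re := by
    refine hmonoR.injOn h₁ h₂ ?_
    simp only [e₁, e₂]
    simpa using congrArg re heq
  rw [← e₁, ← e₂, hs]

/-! ### Estimates for the dilatation of the convolution -/

theorem one_add_ne_zero_of_norm_lt_one {w : ℂ} (hw : ‖w‖ < 1) : 1 + w ≠ 0 := by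
  intro h
  rw [add_eq_zero_iff_neg_eq.mp h |>.symm] at hw
  simp at hw

/-- `w ↦ 1/(1+w)` carries the unit disk onto `Re > 1/2`. It is applied both to `ω` and to `z`
itself. -/
theorem half_lt_re_inv_one_add {w : ℂ} (hw : ‖w‖ < 1) : 1 / 2 < ((1 + w)⁻¹).re := by
  have hne := normSq_pos.2 (one_add_ne_zero_of_norm_lt_one hw)
  have h1 : normSq w < 1 := by
    rw [normSq_eq_norm_sq]
    exact pow_lt_one₀ (norm_nonneg _) hw two_ne_zero
  rw [inv_re, div_lt_div_iff₀ two_pos hne]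
  simp [normSq_apply] at h1 ⊢
  nlinarith

theorem norm_lt_norm_of_normSq_lt {z w : ℂ} (h : normSq z < normSq w) : ‖z‖ < ‖w‖ := by
  rw [normSq_eq_norm_sq, normSq_eq_norm_sq] at h
  exact lt_of_pow_lt_pow_left₀ 2 (norm_nonneg _) h

/-- The Schur–Cohn type estimate behind the case of the dilatation `a z`. -/
theorem norm_quadratic_lt_norm_reciprocal {a z : ℂ} (ha : ‖a‖ = 1) (hz : ‖z‖ < 1) :
    ‖2 * a * z ^ 2 + z - 1‖ < ‖2 + a * z - a * z ^ 2‖ := by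
  have hA : normSq a = 1 := by rw [normSq_eq_norm_sq, ha, one_pow]
  have hZ : normSq z < 1 := by
    rw [normSq_eq_norm_sq]
    exact pow_lt_one₀ (norm_nonneg _) hz two_ne_zero
  have hax : a.re ≤ 1 := (re_le_norm a).trans ha.le
  -- Write `p = 2 + az - az²` and `q = 2az² + z - 1`. Then `p + 2q = z(3az + a + 2)` and `2p + q = 3
  -- + (2a+1)z`, which lowers the degree to one. Equality holds here for `a = 1`; the extra factor
  -- `z` restores strictness.
  have hle : ‖3 * a * z + (a + 2)‖ ≤ ‖3 + (2 * a + 1) * z‖ := by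
    rw [← sq_le_sq₀ (norm_nonneg _) (norm_nonneg _), ← normSq_eq_norm_sq, ← normSq_eq_norm_sq,
      ← sub_nonneg]
    have : normSq (3 + (2 * a + 1) * z) - normSq (3 * a * z + (a + 2)) =
        4 * (1 - a.re) * (1 - normSq z) := by
      simp [normSq_apply] at hA ⊢
      linear_combination (-5 * (z.re * z.re + z.im * z.im) - 1 - 6 * z.re) * hA
    rw [this]
    exact mul_nonneg (by linarith) (by linarith)
  have hpos : 0 < ‖3 + (2 * a + 1) * z‖ := by
    refine norm_pos_iff.2 fun h => ?_
    have h2 : ‖(2 * a + 1) * z‖ = 3 := by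
      rw [add_eq_zero_iff_neg_eq.mp h |>.symm]
      simp
    have h3 : ‖2 * a + 1‖ ≤ 3 := by
      refine (norm_add_le _ _).trans ?_
      rw [norm_mul, ha]
      norm_num
    rw [norm_mul] at h2
    nlinarith [norm_nonneg z]
  have hlt : ‖z * (3 * a * z + (a + 2))‖ < ‖3 + (2 * a + 1) * z‖ := by
    rw [norm_mul]
    nlinarith [norm_nonneg z]
  apply norm_lt_norm_of_normSq_lt
  -- `|2p + q|² - |p + 2q|² = 3(|p|² - |q|²)`.
  have h4 := pow_lt_pow_left₀ hlt (norm_nonneg _) two_ne_zero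
  rw [← normSq_eq_norm_sq, ← normSq_eq_norm_sq,
    show z * (3 * a * z + (a + 2)) = (2 + a * z - a * z ^ 2) + 2 * (2 * a * z ^ 2 + z - 1) by ring,
    show 3 + (2 * a + 1) * z = 2 * (2 + a * z - a * z ^ 2) + (2 * a * z ^ 2 + z - 1) by ring] at h4
  generalize 2 + a * z - a * z ^ 2 = p at *
  generalize 2 * a * z ^ 2 + z - 1 = q at *
  simp [normSq_apply] at h4 ⊢
  nlinarith

theorem norm_mul_pow_lt_one {a z : ℂ} (ha : ‖a‖ = 1) (hz : ‖z‖ < 1) {n : ℕ} (hn : n ≠ 0) :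
    ‖a * z ^ n‖ < 1 := by
  rw [norm_mul, norm_pow, ha, one_mul]
  exact pow_lt_one₀ (norm_nonneg _) hz hn

/-- For the dilatation `ω = a zⁿ`, `n = 1, 2`, the dilatation of the convolution is the quotient
of these two polynomials. -/
theorem norm_conv_numerator_lt_norm_conv_denominator {a z : ℂ} (ha : ‖a‖ = 1) (hz : ‖z‖ < 1)
    {n : ℕ} (hn : n = 1 ∨ n = 2) :
    ‖2 * z * (a * z ^ n) * (1 + a * z ^ n) - n * (a * z ^ n) * (1 + z)‖ <
      ‖2 * (1 + a * z ^ n) - n * (a * z ^ n) * (1 + z)‖ := by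
  rcases hn with rfl | rfl
  · have h := norm_quadratic_lt_norm_reciprocal ha hz
    rw [show 2 * z * (a * z ^ 1) * (1 + a * z ^ 1) - (1 : ℕ) * (a * z ^ 1) * (1 + z) =
        (a * z ^ 1) * (2 * a * z ^ 2 + z - 1) by push_cast; ring,
      show 2 * (1 + a * z ^ 1) - (1 : ℕ) * (a * z ^ 1) * (1 + z) = 2 + a * z - a * z ^ 2 by
        push_cast; ring, norm_mul]
    exact (mul_le_of_le_one_left (norm_nonneg _)
      (norm_mul_pow_lt_one ha hz one_ne_zero).le).trans_lt h
  -- For `n = 2` the factor `1 - a z³` is common, and the dilatation is exactly `-a z²`.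
  · rw [show 2 * z * (a * z ^ 2) * (1 + a * z ^ 2) - (2 : ℕ) * (a * z ^ 2) * (1 + z) =
        -(a * z ^ 2) * (2 * (1 + -a * z ^ 3)) by push_cast; ring,
      show 2 * (1 + a * z ^ 2) - (2 : ℕ) * (a * z ^ 2) * (1 + z) = 2 * (1 + -a * z ^ 3) by
        push_cast; ring, norm_mul, norm_neg]
    refine mul_lt_of_lt_one_left (norm_pos_iff.2 (mul_ne_zero two_ne_zero ?_))
      (norm_mul_pow_lt_one ha hz two_ne_zero)
    exact one_add_ne_zero_of_norm_lt_one
      (norm_mul_pow_lt_one (by rwa [norm_neg]) hz three_ne_zero)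

/-! ### Explicit derivatives of `f` and of the convolution -/

theorem HarmonicMap.h_add_g_of_mem_classS0_pi {f : HarmonicMap} (hf : f ∈ classS0 Real.pi)
    {z : ℂ} (hz : z ∈ ball (0 : ℂ) 1) : f.h z + f.g z = z / (1 + z) := by
  have h0 : (0 : ℂ) ∈ ball (0 : ℂ) 1 := mem_ball_self one_pos
  refine eq_div_one_add_of_re_lt_half (φ := fun z => f.h z + f.g z)
    (f.h_analytic.add f.g_analytic) (by simp [f.h_zero, f.g_zero]) ?_ (fun z hz => ?_) hz
  · rw [deriv_fun_add (f.h_analytic.differentiableAt (isOpen_ball.mem_nhds h0))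
      (f.g_analytic.differentiableAt (isOpen_ball.mem_nhds h0)), f.h_deriv_zero, hf.1.2, add_zero]
  · have h : f.toFun z ∈ slantedHalfPlane Real.pi := hf.2 ▸ Set.mem_image_of_mem _ hz
    simp only [slantedHalfPlane, Set.mem_ofPred_eq, exp_pi_mul_I, neg_mul, one_mul, neg_re,
      HarmonicMap.toFun, add_re, conj_re] at h
    simp only [add_re]
    linarith

/-- The derivatives of the analytic and co-analytic parts are determined by the dilatation. -/
theorem HarmonicMap.deriv_of_mem_classS0_pi {f : HarmonicMap} (hf : f ∈ classS0 Real.pi)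
    {ω : ℂ → ℂ} (hω1 : ∀ z ∈ ball (0 : ℂ) 1, ‖ω z‖ < 1)
    (hω : ∀ z ∈ ball (0 : ℂ) 1, f.dilatation z = ω z) {z : ℂ} (hz : z ∈ ball (0 : ℂ) 1) :
    deriv f.h z = 1 / ((1 + ω z) * (1 + z) ^ 2) ∧
      deriv f.g z = ω z / ((1 + ω z) * (1 + z) ^ 2) := by
  have hnz : 1 + z ≠ 0 := one_add_ne_zero_of_norm_lt_one (by simpa using hz)
  have hnω : 1 + ω z ≠ 0 := one_add_ne_zero_of_norm_lt_one (hω1 z hz)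
  have hJ := hf.1.1.1 z hz
  have hh : deriv f.h z ≠ 0 := by
    intro h
    rw [HarmonicMap.jacobian, h, norm_zero] at hJ
    nlinarith [sq_nonneg ‖deriv f.g z‖]
  have hg : deriv f.g z = ω z * deriv f.h z := by
    rw [← hω z hz, HarmonicMap.dilatation, div_mul_cancel₀ _ hh]
  have hsum : deriv f.h z + deriv f.g z = 1 / (1 + z) ^ 2 := by
    have hb := isOpen_ball.mem_nhds hz
    rw [← deriv_fun_add (f.h_analytic.differentiableAt hb) (f.g_analytic.differentiableAt hb)]
    have he : (fun z => f.h z + f.g z) =ᶠ[nhds z] fun z => z / (1 + z) := by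
      filter_upwards [hb] with w hw using HarmonicMap.h_add_g_of_mem_classS0_pi hf hw
    rw [he.deriv_eq, ((hasDerivAt_id' z).fun_div ((hasDerivAt_id' z).const_add 1) hnz).deriv]
    ring
  have hH : deriv f.h z = 1 / ((1 + ω z) * (1 + z) ^ 2) := by
    rw [hg] at hsum
    field_simp at hsum ⊢
    linear_combination hsum
  exact ⟨hH, by rw [hg, hH, mul_one_div]⟩

/-- Differentiate `(u + z u')/2` and `(v - z v')/2`. The two results are kept over a common
denominator so that the dilatation is the quotient of the numerators. -/
theorem hasDerivAt_hadamard_f₀ {u v : ℂ → ℂ} (hu : DifferentiableOn ℂ u (ball 0 1)) (hu0 : u 0 = 0)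
    (hv : DifferentiableOn ℂ v (ball 0 1)) (hv0 : v 0 = 0) {a : ℂ} {n : ℕ}
    (hω1 : ∀ z ∈ ball (0 : ℂ) 1, ‖a * z ^ n‖ < 1)
    (hu' : ∀ z ∈ ball (0 : ℂ) 1, deriv u z = 1 / ((1 + a * z ^ n) * (1 + z) ^ 2))
    (hv' : ∀ z ∈ ball (0 : ℂ) 1, deriv v z = a * z ^ n / ((1 + a * z ^ n) * (1 + z) ^ 2))
    {z : ℂ} (hz : z ∈ ball (0 : ℂ) 1) :
    HasDerivAt (hadamard f₀.h u) ((2 * (1 + a * z ^ n) - n * (a * z ^ n) * (1 + z)) /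
        (2 * (1 + a * z ^ n) ^ 2 * (1 + z) ^ 3)) z ∧
      HasDerivAt (hadamard f₀.g v)
        ((2 * z * (a * z ^ n) * (1 + a * z ^ n) - n * (a * z ^ n) * (1 + z)) /
          (2 * (1 + a * z ^ n) ^ 2 * (1 + z) ^ 3)) z := by
  have hnz : 1 + z ≠ 0 := one_add_ne_zero_of_norm_lt_one (by simpa using hz)
  have hnω : 1 + a * z ^ n ≠ 0 := one_add_ne_zero_of_norm_lt_one (hω1 z hz)
  have hb := isOpen_ball.mem_nhds hz
  have hω : HasDerivAt (fun z : ℂ => a * z ^ n) (a * (n * z ^ (n - 1))) z :=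
    (hasDerivAt_pow n z).const_mul a
  have hzω : z * (a * (n * z ^ (n - 1))) = n * (a * z ^ n) := by
    rcases n with _ | n
    · simp
    · rw [Nat.add_sub_cancel, pow_succ]; ring
  have hq : HasDerivAt (fun z : ℂ => (1 + a * z ^ n) * (1 + z) ^ 2)
      (a * (n * z ^ (n - 1)) * (1 + z) ^ 2 + (1 + a * z ^ n) * (2 * (1 + z))) z := by
    simpa using (hω.const_add 1).fun_mul (((hasDerivAt_id' z).const_add 1).fun_pow 2)
  have hq0 : (1 + a * z ^ n) * (1 + z) ^ 2 ≠ 0 := mul_ne_zero hnω (pow_ne_zero 2 hnz)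
  have hu1 := (hu.differentiableAt hb).hasDerivAt
  have hv1 := (hv.differentiableAt hb).hasDerivAt
  have hu2 := ((hasDerivAt_const z (1 : ℂ)).fun_div hq hq0).congr_of_eventuallyEq
    (Filter.eventually_of_mem hb hu')
  have hv2 := (hω.fun_div hq hq0).congr_of_eventuallyEq (Filter.eventually_of_mem hb hv')
  rw [hu' z hz] at hu1
  rw [hv' z hz] at hv1
  have hH := ((hu1.fun_add ((hasDerivAt_id' z).fun_mul hu2)).div_const 2).congr_of_eventuallyEq
    (Filter.eventually_of_mem hb fun w hw => hadamard_f₀_h hu hu0 hw)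
  have hG := ((hv1.fun_sub ((hasDerivAt_id' z).fun_mul hv2)).div_const 2).congr_of_eventuallyEq
    (Filter.eventually_of_mem hb fun w hw => hadamard_f₀_g hv hv0 hw)
  rw [hu' z hz] at hH
  rw [hv' z hz] at hG
  generalize a * (n * z ^ (n - 1)) = ω' at *
  rw [← hzω]
  generalize a * z ^ n = ω at *
  constructor
  · convert! hH using 1
    field_simp
    ring
  · convert! hG using 1
    field_simp
    ring

/-! ### Local and global univalence of the convolution -/

theorem mainTheorem6 (f : HarmonicMap) (n : ℕ) (θ : ℝ) (hn : n = 1 ∨ n = 2)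
    (hf : f ∈ classS0 Real.pi)
    (hω : ∀ z ∈ ball (0 : ℂ) 1, f.dilatation z = exp (θ * I) * z ^ n) :
    HarmonicMap.conv f₀ f ∈ classSH0 := by
  have ha : ‖exp (θ * I)‖ = 1 := norm_exp_ofReal_mul_I θ
  generalize exp (θ * I) = a at *
  have hn0 : n ≠ 0 := by omega
  have hω1 : ∀ z ∈ ball (0 : ℂ) 1, ‖a * z ^ n‖ < 1 := fun z hz =>
    norm_mul_pow_lt_one ha (by simpa using hz) hn0
  have hd := fun z (hz : z ∈ ball (0 : ℂ) 1) =>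
    HarmonicMap.deriv_of_mem_classS0_pi (ω := fun z => a * z ^ n) hf hω1 hω hz
  have hD := fun z (hz : z ∈ ball (0 : ℂ) 1) =>
    hasDerivAt_hadamard_f₀ f.h_analytic f.h_zero f.g_analytic f.g_zero hω1
      (fun z hz => (hd z hz).1) (fun z hz => (hd z hz).2) hz
  set F := HarmonicMap.conv f₀ f with hF
  have hlt : ∀ z ∈ ball (0 : ℂ) 1, ‖deriv F.g z‖ < ‖deriv F.h z‖ := by
    intro z hz
    have hz1 : ‖z‖ < 1 := by simpa using hz
    have h1 : deriv F.h z = _ := (hD z hz).1.deriv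
    have h2 : deriv F.g z = _ := (hD z hz).2.deriv
    rw [h1, h2, norm_div, norm_div]
    refine div_lt_div_of_pos_right (norm_conv_numerator_lt_norm_conv_denominator ha hz1 hn) ?_
    exact norm_pos_iff.2 (mul_ne_zero (mul_ne_zero two_ne_zero
      (pow_ne_zero 2 (one_add_ne_zero_of_norm_lt_one (hω1 z hz))))
      (pow_ne_zero 3 (one_add_ne_zero_of_norm_lt_one hz1)))
  refine ⟨⟨fun z hz => ?_, ?_⟩, ?_⟩
  · exact sub_pos.2 (pow_lt_pow_left₀ (hlt z hz) (norm_nonneg _) two_ne_zero)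
  · have hne : ∀ ζ : ℂ, ζ.re < 1 / 2 → 1 - ζ ≠ 0 := by
      intro ζ h h0
      rw [← sub_eq_zero.mp h0] at h
      norm_num at h
    have hm : ∀ ζ : ℂ, ζ.re < 1 / 2 → ζ / (1 - ζ) ∈ ball (0 : ℂ) 1 := by
      intro ζ h
      rw [mem_ball_zero_iff, norm_div, div_lt_one (norm_pos_iff.2 (hne ζ h))]
      apply norm_lt_norm_of_normSq_lt
      simp [normSq_apply]
      nlinarith
    -- The inverse substitution `z = ζ/(1-ζ)` has derivative `1/(1-ζ)² = (1+z)²`.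
    have hm' : ∀ ζ : ℂ, ζ.re < 1 / 2 → HasDerivAt (fun ζ : ℂ => ζ / (1 - ζ))
        ((1 + ζ / (1 - ζ)) ^ 2) ζ := by
      intro ζ h
      have h1 := hne ζ h
      convert! (hasDerivAt_id' ζ).fun_div ((hasDerivAt_id' ζ).const_sub 1) h1 using 1
      field_simp
      ring
    have key := injOn_add_conj_of_re_deriv_sub_ge
      (fun ζ h => (hD _ (hm ζ h)).1.comp ζ (hm' ζ h))
      (fun ζ h => (hD _ (hm ζ h)).2.comp ζ (hm' ζ h)) ?_ ?_
    · have hback : ∀ z ∈ ball (0 : ℂ) 1, (z / (1 + z)).re < 1 / 2 ∧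
          z / (1 + z) / (1 - z / (1 + z)) = z := by
        intro z hz
        have hz1 : ‖z‖ < 1 := by simpa using hz
        have h1 := one_add_ne_zero_of_norm_lt_one hz1
        refine ⟨?_, by field_simp; ring⟩
        have h2 := half_lt_re_inv_one_add hz1
        have h3 : z / (1 + z) = 1 - (1 + z)⁻¹ := by field_simp; ring
        rw [h3, sub_re, one_re]
        linarith
      intro z₁ hz₁ z₂ hz₂ h
      obtain ⟨r₁, e₁⟩ := hback z₁ hz₁
      obtain ⟨r₂, e₂⟩ := hback z₂ hz₂
      rw [← e₁, ← e₂]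
      rw [← e₁, ← e₂] at h
      rw [key r₁ r₂ h]
    · intro ζ h
      have h1 := one_add_ne_zero_of_norm_lt_one (mem_ball_zero_iff.1 (hm ζ h))
      have h2 : deriv F.h _ = _ := (hD _ (hm ζ h)).1.deriv
      have h3 : deriv F.g _ = _ := (hD _ (hm ζ h)).2.deriv
      rw [← h2, ← h3, norm_mul, norm_mul]
      exact mul_lt_mul_of_pos_right (hlt _ (hm ζ h)) (norm_pos_iff.2 (pow_ne_zero 2 h1))
    · intro ζ h
      have h1 := one_add_ne_zero_of_norm_lt_one (mem_ball_zero_iff.1 (hm ζ h))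
      have h2 := one_add_ne_zero_of_norm_lt_one (hω1 _ (hm ζ h))
      have h3 := half_lt_re_inv_one_add (hω1 _ (hm ζ h))
      have h4 : ζ = ζ / (1 - ζ) / (1 + ζ / (1 - ζ)) := by
        have := hne ζ h
        field_simp
        ring
      -- With `z = ζ/(1-ζ)`, `(H' - G')(1+z)² = (1 - zω)/((1+ω)(1+z)) = 1/(1+ω) - z/(1+z)`.
      have h5 : (1 / 2 : ℝ) - ζ.re ≤ ((1 + a * (ζ / (1 - ζ)) ^ n)⁻¹ - ζ).re := by
        rw [sub_re]
        linarith
      refine h5.trans_eq (congrArg re ?_)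
      refine (congrArg (fun x => (1 + a * (ζ / (1 - ζ)) ^ n)⁻¹ - x) h4).trans ?_
      generalize ζ / (1 - ζ) = q at *
      generalize a * q ^ n = w at *
      field_simp
      ring
  · exact (hadamard_deriv_zero f₀.g_analytic f.g_analytic).trans (by rw [hf.1.2, mul_zero])
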